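/- Let $\mathbf{FRel}$ be the dagger symmetric monoidal category of finite sets and relations, with $\otimes=\times$ and with the converse relation as dagger. An *observable* on an object $A$ of a dagger symmetric monoidal category ($\dagger$-SMC) is a commutative $\dagger$-Frobenius algebra $(\mu,\eta,\delta=\mu^\dagger,\epsilon=\eta^\dagger)$ on $A$ that is quasi-special ($\mu\circ\delta$ is the identity up to an invertible scalar). A *classical point* of an observable is a state $j:I\to A$ with $\delta\circ j=j\otimes j$ and $\epsilon\circ j=1$. A *phase state* is a state $\alpha$ with $(\alpha^\dagger\otimes 1)\circ\delta\circ\alpha=\eta$; phase states are added by $\alpha+\beta=\mu\circ(\alpha\otimes\beta)$, and the corresponding *phase* is the map $\mu\circ(1\otimes\alpha):A\to A$. A pair $(Z,X)$ of observables on $A$ is *strongly complementary* if $\delta_Z\mu_X=(\mu_X\otimes\mu_X)(1\otimes\sigma\otimes1)(\delta_Z\otimes\delta_Z)$ (where $\sigma$ is the symmetry), $\delta_Z\eta_X=\eta_X\otimes\eta_X$ and $\epsilon_Z\mu_X=\epsilon_Z\otimes\epsilon_Z$. An *$N$-partite Mermin measurement* is given by $Z$-phase states $\alpha_1,\dots,\alpha_N$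 whose sum is an $X$-classical point. Its state on $A^{\otimes N}$ is $(\psi^\dagger\otimes 1)\circ\delta_X^{(N)}\circ\psi$, where $\psi$ is the $N$-partite GHZ state of $Z$ (the $Z$-spider with no inputs and $N$ outputs) with the phases $\alpha_1,\dots,\alpha_N$ applied to its components, $\delta_X^{(N)}:A^{\otimes N}\to A^{\otimes N}\otimes A^{\otimes N}$ is the componentwise comultiplication of $X$, and $\psi^\dagger$ acts on its first factor. A *Mermin scenario* is a non-empty finite family $(\alpha^s_1,\dots,\alpha^s_N)_{s=1,\dots,S}$ of such measurements; let $a_1,\dots,a_M$ be the distinct phase states appearing in it. Its *local map* $A^{\otimes(N\cdot M)}\to A^{\otimes(S\cdot N)}$ sends each input wire $(i,r)$ into an $X$-spider whose output legs are exactly the wires $(s,i)$ with $\alpha^s_i=a_r$. A *local hidden variable model* is a state $\Lambda'$ of $A^{\otimes (N\cdot M)}$ such that for every $s$, applying the local map to $\Lambda'$ and then $\epsilon_X$ to all the output wires $(t,j)$ with $t\neq s$ gives the state of the $s$-th Mermin measurement. A $\dagger$-SMC is *Mermin local* if for every strongly complementary pair of observables every Mermin scenario has a local hidden variable model. An abelian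 group $P$ is a *trivial algebraic extension* of a subgroup $K$ if every finite system of equations $\sum_j n^p_j x_j=k^p$ with $n^p_j\in\mathbb Z$, $k^p\in K$ that is solvable in $P$ is solvable in $K$. **Corollary.** Let $(Z,X)$ be a strongly complementary pair of observables on a non-empty finite set $A$ in $\mathbf{FRel}$. Then there are abelian groups $G,H$ and a bijection $A\cong G\times H$ under which the pair becomes $(\bigoplus_{h\in H}G,\ \bigoplus_{g\in G}H)$. That is: the $Z$-product of $(g,h)$ and $(g',h')$ is defined iff $h=h'$ and is then $(g+g',h)$, with unit $\eta_Z=\{(0,h):h\in H\}$; the $X$-product of $(g,h)$ and $(g',h')$ is defined iff $g=g'$ and is then $(g,h+h')$, with unit $\eta_X=\{(g,0):g\in G\}$. The $Z$-phase states are exactly the sets $\{(\gamma(h),h):h\in H\}$ with $\gamma:H\to G$, and the $X$-classical points are exactly the sets $\{(g,h):h\in H\}$ with $g\in G$. Under the above addition the $Z$-phase states form a group, isomorphic to $G^H$ via $\{(\gamma(h),h):h\in H\}\mapsto\gamma$. The $X$-classical points form the subgroup that corresponds to the constant vectors, and the group of $Z$-phase states is a trivial algebraic extension of this subgroup. Moreover,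 $\mathbf{FRel}$ is Mermin local. -/

import Mathlib

open CategoryTheory MonoidalCategory

universe u v

namespace Mermin

/-! ### Dagger symmetric monoidal categories -/

/-- A dagger structure on a symmetric monoidal category: an identity-on-objects, involutive,
contravariant functor that is compatible with the tensor product and for which the coherence
isomorphisms are unitary. -/
class DaggerSMC (C : Type u) [Category.{v} C] [MonoidalCategory C] [SymmetricCategory C] where
  /-- The adjoint of a morphism. -/
  dagger {A B : C} (f : A ⟶ B) : B ⟶ A
  dagger_dagger {A B : C} (f : A ⟶ B) : dagger (dagger f) = f
  dagger_id (A : C) : dagger (𝟙 A) = 𝟙 A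
  dagger_comp {A B D : C} (f : A ⟶ B) (g : B ⟶ D) : dagger (f ≫ g) = dagger g ≫ dagger f
  dagger_tensor {A B A' B' : C} (f : A ⟶ B) (g : A' ⟶ B') :
    dagger (f ⊗ₘ g) = dagger f ⊗ₘ dagger g
  dagger_associator (A B D : C) : dagger (α_ A B D).hom = (α_ A B D).inv
  dagger_leftUnitor (A : C) : dagger (λ_ A).hom = (λ_ A).inv
  dagger_rightUnitor (A : C) : dagger (ρ_ A).hom = (ρ_ A).inv
  dagger_braiding (A B : C) : dagger (β_ A B).hom = (β_ A B).inv

open DaggerSMC (dagger)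

section Observables

variable {C : Type u} [Category.{v} C] [MonoidalCategory C] [SymmetricCategory C] [DaggerSMC C]

/-! ### Observables, classical states and phases -/

/-- A dagger Frobenius algebra on `A`: a monoid on `A` which satisfies the Frobenius law together
with its adjoint comonoid. -/
structure DaggerFrobenius (A : C) extends MonObj A where
  frobenius_left : (A ◁ dagger mul) ≫ (α_ A A A).inv ≫ (mul ▷ A) = mul ≫ dagger mul
  frobenius_right : (dagger mul ▷ A) ≫ (α_ A A A).hom ≫ (A ◁ mul) = mul ≫ dagger mul

/-- A quasi-special commutative dagger Frobenius algebra: comultiplication followed by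
multiplication is the identity, up to an invertible scalar. -/
structure Observable (A : C) extends DaggerFrobenius A where
  commutative : (β_ A A).hom ≫ mul = mul
  quasiSpecial : ∃ N : 𝟙_ C ≅ 𝟙_ C,
    dagger mul ≫ mul = (λ_ A).inv ≫ (N.hom ▷ A) ≫ (λ_ A).hom

namespace Observable

variable {A : C}

/-- The multiplication `A ⊗ A ⟶ A`. -/
def mult (Z : Observable A) : A ⊗ A ⟶ A := Z.mul

/-- The unit state. -/
def unit (Z : Observable A) : 𝟙_ C ⟶ A := Z.one

/-- The comultiplication, adjoint to the multiplication. -/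
def comul (Z : Observable A) : A ⟶ A ⊗ A := dagger Z.mult

/-- The counit, adjoint to the unit. -/
def counit (Z : Observable A) : A ⟶ 𝟙_ C := dagger Z.unit

/-- Classical points: the states that are copied by the comultiplication and deleted by the
counit. -/
def IsClassical (X : Observable A) (j : 𝟙_ C ⟶ A) : Prop :=
  j ≫ X.comul = (λ_ (𝟙_ C)).inv ≫ (j ⊗ₘ j) ∧ j ≫ X.counit = 𝟙 (𝟙_ C)

/-- Phase states: multiplying `a` with its conjugate gives the unit. The conjugate of `a` on a
reversed input wire of the multiplication is the effect `dagger a` on an output wire of the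
comultiplication. -/
def IsPhaseState (Z : Observable A) (a : 𝟙_ C ⟶ A) : Prop :=
  a ≫ Z.comul ≫ (dagger a ▷ A) ≫ (λ_ A).hom = Z.unit

/-- The phase states of an observable. -/
@[ext]
structure PhaseState (Z : Observable A) where
  state : 𝟙_ C ⟶ A
  isPhaseState : Z.IsPhaseState state

/-- The group operation on phase states: multiply the two states. -/
def add (Z : Observable A) (a b : 𝟙_ C ⟶ A) : 𝟙_ C ⟶ A :=
  (λ_ (𝟙_ C)).inv ≫ (a ⊗ₘ b) ≫ Z.mult

/-- The sum `a 0 + ⋯ + a (n - 1)` for the operation `add`; the empty sum is the unit state. -/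
def sum (Z : Observable A) : (n : ℕ) → (Fin n → (𝟙_ C ⟶ A)) → (𝟙_ C ⟶ A)
  | 0, _ => Z.unit
  | n + 1, a => Z.add (a 0) (Z.sum n fun i => a i.succ)

/-- The phase (an endomorphism of `A`) given by a phase state: multiply by that state. -/
def phaseMap (Z : Observable A) (a : 𝟙_ C ⟶ A) : A ⟶ A :=
  (ρ_ A).inv ≫ (A ◁ a) ≫ Z.mult

/-- Strongly complementary pairs: the bialgebra equation and the two coherence equations. -/
structure StronglyComplementary (Z X : Observable A) : Prop where
  bialgebra :
    X.mult ≫ Z.comul = (Z.comul ⊗ₘ Z.comul) ≫ tensorμ A A A A ≫ (X.mult ⊗ₘ X.mult)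
  unit_copy : X.unit ≫ Z.comul = (λ_ (𝟙_ C)).inv ≫ (X.unit ⊗ₘ X.unit)
  counit_copy : X.mult ≫ Z.counit = (Z.counit ⊗ₘ Z.counit) ≫ (λ_ (𝟙_ C)).hom

end Observable

/-! ### Many systems -/

/-- The tensor power of `n` copies of `A`. -/
def pow (A : C) : ℕ → C
  | 0 => 𝟙_ C
  | n + 1 => A ⊗ pow A n

/-- The tensor product of `n` endomorphisms of `A`. -/
def powMap {A : C} : (n : ℕ) → (Fin n → (A ⟶ A)) → (pow A n ⟶ pow A n)
  | 0, _ => 𝟙 (𝟙_ C)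
  | n + 1, f => f 0 ⊗ₘ powMap n fun i => f i.succ

namespace Observable

variable {A : C}

/-- The spider with one input and `n` outputs, i.e. the iterated comultiplication. -/
def spider (Z : Observable A) : (n : ℕ) → (A ⟶ pow A n)
  | 0 => Z.counit
  | n + 1 => Z.comul ≫ (A ◁ Z.spider n)

/-- The `n`-partite GHZ state: the spider with no inputs and `n` outputs. -/
def ghz (Z : Observable A) (n : ℕ) : 𝟙_ C ⟶ pow A n := Z.unit ≫ Z.spider n

/-- Comultiply on every one of `n` wires; the first outputs of all comultiplications are collected
in the first factor, the second outputs in the second factor. -/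
def comulPow (X : Observable A) : (n : ℕ) → (pow A n ⟶ pow A n ⊗ pow A n)
  | 0 => (λ_ (𝟙_ C)).inv
  | n + 1 => (X.comul ⊗ₘ X.comulPow n) ≫ tensorμ A A (pow A n) (pow A n)

/-- Apply the counit to every one of `n` wires. -/
def counitPow (X : Observable A) : (n : ℕ) → (pow A n ⟶ 𝟙_ C)
  | 0 => 𝟙 (𝟙_ C)
  | n + 1 => (X.counit ⊗ₘ X.counitPow n) ≫ (λ_ (𝟙_ C)).hom

/-- Keep the wire `i` and apply the counit to all the others. -/
def proj (X : Observable A) : (n : ℕ) → Fin n → (pow A n ⟶ A)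
  | 0, i => i.elim0
  | n + 1, i =>
    Fin.cases ((A ◁ X.counitPow n) ≫ (ρ_ A).hom)
      (fun k => (X.counit ▷ pow A n) ≫ (λ_ (pow A n)).hom ≫ X.proj n k) i

/-- The map from `m` to `n` wires in which every input wire `i` ends in an `X` node, and the node
of `i` is connected to exactly those output wires `k` for which `f k = i` (so that it is the
counit if there are none). As `X` is a cocommutative comonoid, this map is obtained by making `n`
copies of all the inputs and keeping the wire `f k` of the `k`-th copy. -/
def wiring (X : Observable A) (m : ℕ) : (n : ℕ) → (Fin n → Fin m) → (pow A m ⟶ pow A n)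
  | 0, _ => X.counitPow m
  | n + 1, f => X.comulPow m ≫ (X.proj m (f 0) ⊗ₘ X.wiring m n fun k => f k.succ)

/-- The Mermin measurement: prepare a GHZ state `ψ` for `Z` with the phase `a i` applied to its
`i`-th component, take the state `ψ` together with its conjugate, and measure each component in
`X`, i.e. join the `i`-th components of `ψ` and of the conjugate of `ψ` in an `X` node with one
output. As in `IsPhaseState`, the conjugate of `ψ` on reversed wires is the effect `dagger ψ`
applied to outputs of comultiplications. -/
def merminMeasurement (Z X : Observable A) (n : ℕ) (a : Fin n → (𝟙_ C ⟶ A)) : 𝟙_ C ⟶ pow A n :=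
  let ψ : 𝟙_ C ⟶ pow A n := Z.ghz n ≫ powMap n fun i => Z.phaseMap (a i)
  ψ ≫ X.comulPow n ≫ (dagger ψ ▷ pow A n) ≫ (λ_ (pow A n)).hom

/-! ### Mermin scenarios and local hidden variable models -/

/-- An `N`-partite Mermin measurement scenario: a non-empty finite collection of `S` measurements,
in which the phase of component `i` in measurement `s` is `phase (setting s i)`; here
`phase 0, …, phase (M - 1)` are the distinct phases that appear in the scenario. The phases of each
measurement sum to a classical point of `X`. -/
structure Scenario (Z X : Observable A) where
  N : ℕ
  S : ℕ
  M : ℕ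
  S_pos : 0 < S
  phase : Fin M → Z.PhaseState
  setting : Fin S → Fin N → Fin M
  distinct : Function.Injective phase
  appears : ∀ r : Fin M, ∃ s i, setting s i = r
  classical : ∀ s : Fin S, X.IsClassical (Z.sum N fun i => (phase (setting s i)).state)

namespace Scenario

variable {Z X : Observable A} (𝒮 : Scenario Z X)

/-- The state given by the `s`-th measurement of the scenario. -/
def measurement (s : Fin 𝒮.S) : 𝟙_ C ⟶ pow A 𝒮.N :=
  merminMeasurement Z X 𝒮.N fun i => (𝒮.phase (𝒮.setting s i)).state

/-- The local map: the input wires form `N` groups (systems) of `M` wires (phases), the output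
wires form `S` groups (measurements) of `N` wires (systems), and the node of the input wire
`(i, r)` is connected to the output wire `(s, j)` if and only if `i = j` and the phase of system
`j` in measurement `s` is the `r`-th one. -/
def localMap : pow A (𝒮.N * 𝒮.M) ⟶ pow A (𝒮.S * 𝒮.N) :=
  X.wiring (𝒮.N * 𝒮.M) (𝒮.S * 𝒮.N) fun k =>
    let s : Fin 𝒮.S := (finProdFinEquiv.symm k).1
    let j : Fin 𝒮.N := (finProdFinEquiv.symm k).2
    finProdFinEquiv (j, 𝒮.setting s j)

/-- Apply the counit of `X` to each output wire of all the measurements except `s`. -/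
def restrict (s : Fin 𝒮.S) : pow A (𝒮.S * 𝒮.N) ⟶ pow A 𝒮.N :=
  X.wiring (𝒮.S * 𝒮.N) 𝒮.N fun j => finProdFinEquiv (s, j)

/-- A local hidden variable model exists: a state of the `N * M` input wires such that, after the
local map, the restriction to each measurement `s` is the state given by that measurement. -/
def HasLocalHiddenVariableModel : Prop :=
  ∃ Λ : 𝟙_ C ⟶ pow A (𝒮.N * 𝒮.M),
    ∀ s : Fin 𝒮.S, (Λ ≫ 𝒮.localMap) ≫ 𝒮.restrict s = 𝒮.measurement s

end Scenario

end Observable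

end Observables

/-- A dagger symmetric monoidal category is Mermin non-local if some Mermin scenario for some
strongly complementary pair of observables has no local hidden variable model. -/
def MerminNonLocal (C : Type u) [Category.{v} C] [MonoidalCategory C] [SymmetricCategory C]
    [DaggerSMC C] : Prop :=
  ∃ (A : C) (Z X : Observable A), Z.StronglyComplementary X ∧
    ∃ 𝒮 : Observable.Scenario Z X, ¬ 𝒮.HasLocalHiddenVariableModel

/-- Mermin local: not Mermin non-local. -/
def MerminLocal (C : Type u) [Category.{v} C] [MonoidalCategory C] [SymmetricCategory C]
    [DaggerSMC C] : Prop :=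
  ¬ MerminNonLocal C

/-! ### Algebraic extensions -/

/-- `G` is a non-trivial algebraic extension of its subgroup `K` if some finite system of equations
with integer coefficients and right-hand sides in `K` has a solution in `G` but none in `K`. -/
def NontrivialAlgebraicExtension {G : Type*} [AddCommGroup G] (K : AddSubgroup G) : Prop :=
  ∃ (l m : ℕ) (n : Fin m → Fin l → ℤ) (h : Fin m → K),
    (∃ x : Fin l → G, ∀ p, ∑ j, n p j • x j = (h p : G)) ∧
      ¬ ∃ x : Fin l → K, ∀ p, ∑ j, n p j • x j = h p

/-- A trivial algebraic extension is one that is not non-trivial. -/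
def TrivialAlgebraicExtension {G : Type*} [AddCommGroup G] (K : AddSubgroup G) : Prop :=
  ¬ NontrivialAlgebraicExtension K

/-! ### Finite sets and relations -/

/-- The objects of the category of finite sets and relations. -/
structure FRel : Type (u + 1) where
  carrier : Type u
  [finite : Finite carrier]

namespace FRel

attribute [instance] FRel.finite

/-- Morphisms are relations. -/
@[ext]
structure Hom (A B : FRel.{u}) : Type u where
  rel : A.carrier → B.carrier → Prop

instance : Category.{u} FRel.{u} where
  Hom := Hom
  id _ := ⟨fun a b => a = b⟩
  comp f g := ⟨fun a c => ∃ b, f.rel a b ∧ g.rel b c⟩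
  id_comp f := by apply Hom.ext; funext a b; simp
  comp_id f := by apply Hom.ext; funext a b; simp
  assoc f g h := by
    apply Hom.ext; funext a b; apply propext
    constructor
    · rintro ⟨c, ⟨d, h1, h2⟩, h3⟩; exact ⟨d, h1, c, h2, h3⟩
    · rintro ⟨d, h1, c, h2, h3⟩; exact ⟨c, ⟨d, h1, h2⟩, h3⟩

/-- The relation underlying a morphism. -/
def rel {A B : FRel.{u}} (f : A ⟶ B) : A.carrier → B.carrier → Prop := Hom.rel f

/-- The morphism given by a relation. -/
def ofRel {A B : FRel.{u}} (r : A.carrier → B.carrier → Prop) : A ⟶ B := Hom.mk r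

@[simp] theorem rel_ofRel {A B : FRel.{u}} (r : A.carrier → B.carrier → Prop) (a : A.carrier)
    (b : B.carrier) : rel (ofRel r) a b ↔ r a b := Iff.rfl

@[simp] theorem rel_id {A : FRel.{u}} (a b : A.carrier) : rel (𝟙 A) a b ↔ a = b := Iff.rfl

@[simp] theorem rel_comp {A B D : FRel.{u}} (f : A ⟶ B) (g : B ⟶ D) (a : A.carrier)
    (d : D.carrier) : rel (f ≫ g) a d ↔ ∃ b, rel f a b ∧ rel g b d := Iff.rfl

theorem hom_ext {A B : FRel.{u}} {f g : A ⟶ B} (h : ∀ a b, rel f a b ↔ rel g a b) : f = g := by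
  apply Hom.ext; funext a b; exact propext (h a b)

/-- The isomorphism given by a bijection. -/
def isoOfEquiv {A B : FRel.{u}} (e : A.carrier ≃ B.carrier) : A ≅ B where
  hom := ofRel fun a b => e a = b
  inv := ofRel fun b a => e a = b
  hom_inv_id := hom_ext fun a b => by simp [eq_comm]
  inv_hom_id := hom_ext fun a b => by
    simp only [rel_comp, rel_ofRel, rel_id]
    exact ⟨fun ⟨_, h1, h2⟩ => h1.symm.trans h2, fun h => ⟨e.symm a, by simp, by simp [h]⟩⟩

@[simp] theorem rel_isoOfEquiv_hom {A B : FRel.{u}} (e : A.carrier ≃ B.carrier) (a : A.carrier)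
    (b : B.carrier) : rel (isoOfEquiv e).hom a b ↔ e a = b := Iff.rfl

@[simp] theorem rel_isoOfEquiv_inv {A B : FRel.{u}} (e : A.carrier ≃ B.carrier) (a : A.carrier)
    (b : B.carrier) : rel (isoOfEquiv e).inv b a ↔ e a = b := Iff.rfl

/-- The tensor product is the cartesian product of sets, with a one-point set as its unit. -/
instance : MonoidalCategoryStruct FRel.{u} where
  tensorObj A B := ⟨A.carrier × B.carrier⟩
  tensorUnit := ⟨PUnit.{u + 1}⟩
  tensorHom f g := ofRel fun p q => rel f p.1 q.1 ∧ rel g p.2 q.2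
  whiskerLeft _ _ _ f := ofRel fun p q => p.1 = q.1 ∧ rel f p.2 q.2
  whiskerRight f _ := ofRel fun p q => rel f p.1 q.1 ∧ p.2 = q.2
  associator A B D := isoOfEquiv (Equiv.prodAssoc A.carrier B.carrier D.carrier)
  leftUnitor A := isoOfEquiv (Equiv.punitProd A.carrier)
  rightUnitor A := isoOfEquiv (Equiv.prodPUnit A.carrier)

section Simp

variable {A B A' B' : FRel.{u}}

@[simp] theorem rel_tensorHom (f : A ⟶ B) (g : A' ⟶ B') (a : A.carrier) (a' : A'.carrier)
    (b : B.carrier) (b' : B'.carrier) :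
    rel (f ⊗ₘ g) (a, a') (b, b') ↔ rel f a b ∧ rel g a' b' := Iff.rfl

@[simp] theorem rel_whiskerLeft (f : A ⟶ B) (a : A'.carrier) (b : A.carrier) (a' : A'.carrier)
    (b' : B.carrier) : rel (A' ◁ f) (a, b) (a', b') ↔ a = a' ∧ rel f b b' := Iff.rfl

@[simp] theorem rel_whiskerRight (f : A ⟶ B) (a : A.carrier) (b : A'.carrier) (a' : B.carrier)
    (b' : A'.carrier) : rel (f ▷ A') (a, b) (a', b') ↔ rel f a a' ∧ b = b' := Iff.rfl

@[simp] theorem rel_associator_hom (a : A.carrier) (b : B.carrier) (c : A'.carrier)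
    (a' : A.carrier) (b' : B.carrier) (c' : A'.carrier) :
    rel (α_ A B A').hom ((a, b), c) (a', b', c') ↔ a = a' ∧ b = b' ∧ c = c' := by
  change (a, b, c) = (a', b', c') ↔ _
  simp

@[simp] theorem rel_associator_inv (a : A.carrier) (b : B.carrier) (c : A'.carrier)
    (a' : A.carrier) (b' : B.carrier) (c' : A'.carrier) :
    rel (α_ A B A').inv (a', b', c') ((a, b), c) ↔ a = a' ∧ b = b' ∧ c = c' :=
  rel_associator_hom a b c a' b' c'

@[simp] theorem rel_leftUnitor_hom (x : (𝟙_ FRel.{u}).carrier) (a a' : A.carrier) :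
    rel (λ_ A).hom (x, a) a' ↔ a = a' := Iff.rfl

@[simp] theorem rel_leftUnitor_inv (x : (𝟙_ FRel.{u}).carrier) (a a' : A.carrier) :
    rel (λ_ A).inv a' (x, a) ↔ a = a' := Iff.rfl

@[simp] theorem rel_rightUnitor_hom (x : (𝟙_ FRel.{u}).carrier) (a a' : A.carrier) :
    rel (ρ_ A).hom (a, x) a' ↔ a = a' := Iff.rfl

@[simp] theorem rel_rightUnitor_inv (x : (𝟙_ FRel.{u}).carrier) (a a' : A.carrier) :
    rel (ρ_ A).inv a' (a, x) ↔ a = a' := Iff.rfl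

@[simp] theorem mk_eq_mk (a a' : A.carrier) (b b' : B.carrier) :
    (Eq (α := (A ⊗ B).carrier) (a, b) (a', b')) ↔ a = a' ∧ b = b' := Prod.mk_inj

@[simp] theorem exists_tensor {p : (A ⊗ B).carrier → Prop} :
    (∃ x, p x) ↔ ∃ a : A.carrier, ∃ b : B.carrier, p (a, b) :=
  Prod.exists

@[simp] theorem exists_unit {p : (𝟙_ FRel.{u}).carrier → Prop} : (∃ x, p x) ↔ p PUnit.unit :=
  ⟨fun ⟨_, h⟩ => h, fun h => ⟨_, h⟩⟩

end Simp

instance : MonoidalCategory FRel.{u} where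
  tensorHom_def f g := hom_ext <| by
    rintro ⟨a, b⟩ ⟨c, d⟩
    simp
  id_tensorHom_id A B := hom_ext <| by
    rintro ⟨a, b⟩ ⟨c, d⟩
    simp
  tensorHom_comp_tensorHom f g h k := hom_ext <| by
    rintro ⟨a, b⟩ ⟨c, d⟩
    simp only [rel_comp, rel_tensorHom, exists_tensor]
    constructor
    · rintro ⟨x, y, ⟨h1, h2⟩, h3, h4⟩; exact ⟨⟨x, h1, h3⟩, y, h2, h4⟩
    · rintro ⟨⟨x, h1, h3⟩, y, h2, h4⟩; exact ⟨x, y, ⟨h1, h2⟩, h3, h4⟩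
  whiskerLeft_id A B := hom_ext <| by
    rintro ⟨a, b⟩ ⟨c, d⟩
    simp
  id_whiskerRight A B := hom_ext <| by
    rintro ⟨a, b⟩ ⟨c, d⟩
    simp
  associator_naturality f g h := hom_ext <| by
    rintro ⟨⟨a, b⟩, c⟩ ⟨a', b', c'⟩
    simp [and_assoc]
  leftUnitor_naturality f := hom_ext <| by
    rintro ⟨_, a⟩ b
    simp
  rightUnitor_naturality f := hom_ext <| by
    rintro ⟨a, _⟩ b
    simp
  pentagon W X Y Z := hom_ext <| by
    rintro ⟨⟨⟨a, b⟩, c⟩, d⟩ ⟨a', b', c', d'⟩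
    simp [and_assoc]
  triangle X Y := hom_ext <| by
    rintro ⟨⟨a, _⟩, b⟩ ⟨a', b'⟩
    simp

/-- The symmetry exchanges the two components of a pair. -/
def swap (A B : FRel.{u}) : A ⊗ B ≅ B ⊗ A := isoOfEquiv (Equiv.prodComm A.carrier B.carrier)

@[simp] theorem rel_swap_hom {A B : FRel.{u}} (a a' : A.carrier) (b b' : B.carrier) :
    rel (swap A B).hom (a, b) (b', a') ↔ a = a' ∧ b = b' := by
  change (b, a) = (b', a') ↔ _
  simp [and_comm]

instance : SymmetricCategory FRel.{u} where
  braiding := swap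
  braiding_naturality_right A _ _ f := hom_ext <| by
    rintro ⟨a, b⟩ ⟨c, d⟩
    simp
  braiding_naturality_left f A := hom_ext <| by
    rintro ⟨a, b⟩ ⟨c, d⟩
    simp [and_comm]
  hexagon_forward A B D := hom_ext <| by
    rintro ⟨⟨a, b⟩, c⟩ ⟨b', c', a'⟩
    simp [and_comm, and_left_comm, and_assoc]
  hexagon_reverse A B D := hom_ext <| by
    rintro ⟨a, b, c⟩ ⟨⟨c', a'⟩, b'⟩
    simp [and_comm, and_left_comm, and_assoc]
  symmetry A B := hom_ext <| by
    rintro ⟨a, b⟩ ⟨c, d⟩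
    simp

/-- The dagger of a relation is its converse. -/
instance : DaggerSMC FRel.{u} where
  dagger f := ofRel fun b a => rel f a b
  dagger_dagger _ := rfl
  dagger_id _ := hom_ext fun _ _ => eq_comm
  dagger_comp f g := hom_ext fun _ _ => by simp [and_comm]
  dagger_tensor _ _ := rfl
  dagger_associator _ _ _ := rfl
  dagger_leftUnitor _ := rfl
  dagger_rightUnitor _ := rfl
  dagger_braiding _ _ := rfl

/-! ### Direct sums of copies of a group -/

/-- The subset of `A` corresponding to a state of `A`. -/
def toSet {A : FRel.{u}} (j : 𝟙_ FRel.{u} ⟶ A) : Set A.carrier := {a | rel j PUnit.unit a}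

/-- Under the bijection `e`, the observable `Z` is the groupoid `⨁_{i ∈ I} K`, the disjoint union
of copies of the group `K` indexed by `I`: two elements can be multiplied if and only if they lie
in the same copy, their product is then computed in that copy, and the unit state is the set of
identities. -/
def IsSumOfCopies {A : FRel.{u}} (Z : Observable A) {K I : Type*} [AddCommGroup K]
    (e : A.carrier ≃ K × I) : Prop :=
  (∀ a b c : A.carrier, rel Z.mult (a, b) c ↔
    ((e a).2 = (e b).2 ∧ e c = ((e a).1 + (e b).1, (e a).2))) ∧
  toSet Z.unit = {a | (e a).1 = 0}

end FRel
end Mermin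

namespace Mermin

/-! In `FRel` an observable is an abelian groupoid: quasi-speciality makes its multiplication a
partial function, and the Frobenius law supplies inverses (`groupoid`, `exists_inv`). For a strongly
complementary pair, let `G` be the set of `X`-identities and `H` the set of `Z`-identities. Each
lies in a single component of the other groupoid, hence is a group. The bialgebra equation shows
that taking `X`-identities respects `Z`-products (`src_hom`) and that an element is the same as a
pair of identities (`src_injective`, `src_surjective`). These are the coordinates in `G × H`.

A `Z`-phase state selects one element of each `Z`-component, so it is a vector `γ : H → G`; an
`X`-classical point is an `X`-component, so it is a constant vector. Evaluation at `0 : H` retracts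
all vectors homomorphically onto the constants, so systems solvable among vectors are solvable among
constants.

The same retraction gives locality. A measurement whose phases sum to the constant `g` yields the
tuples with equal `H`-coordinates and with `G`-coordinates summing to `g` (`mem_merminMeasurement`),
and the values `γ r 0` solve all these equations in `G` at once. The `H`-coordinates cause no
conflict, because discarding a wire with the `X`-counit forces its `H`-coordinate to vanish
(`rel_localMap_restrict`). -/

/-- An abelian groupoid, presented by its ternary composition relation and its identities. -/
structure AbelianGroupoid (α : Type*) where
  mul : α → α → α → Prop
  ids : Set α
  mul_unique {a b c d : α} : mul a b c → mul a b d → c = d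
  mul_comm {a b c : α} : mul a b c → mul b a c
  eq_of_id_mul {x a b : α} : x ∈ ids → mul x a b → a = b
  exists_id (a : α) : ∃ x ∈ ids, mul x a a
  assoc {a b c d x : α} : mul a b x → mul x c d → ∃ y, mul b c y ∧ mul a y d
  frobenius {a b c d x : α} : mul a b x → mul c d x → ∃ s, mul s d b ∧ mul a s c

/-! ### Abelian groupoids: sources, inverses, cancellation -/

namespace AbelianGroupoid

variable {α : Type*} (P Q : AbelianGroupoid α)

/-- The identity of the component of an element. -/
noncomputable def src (a : α) : α := (P.exists_id a).choose

theorem src_mem (a : α) : P.src a ∈ P.ids := (P.exists_id a).choose_spec.1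

theorem src_mul (a : α) : P.mul (P.src a) a a := (P.exists_id a).choose_spec.2

variable {P Q}

/-- Associativity makes two identities that fix `a` composable, and each of them then equals their
product. -/
theorem eq_src {x a : α} (hx : x ∈ P.ids) (h : P.mul x a a) : x = P.src a := by
  obtain ⟨y, h1, -⟩ := P.assoc (P.mul_comm h) (P.mul_comm (P.src_mul a))
  have h2 := P.eq_of_id_mul hx h1
  have h3 := P.eq_of_id_mul (P.src_mem a) (P.mul_comm h1)
  exact h3.trans h2.symm ▸ rfl

theorem src_of_mem {x : α} (hx : x ∈ P.ids) : P.src x = x :=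
  P.eq_of_id_mul hx (P.mul_comm (P.src_mul x))

theorem src_eq_left {a b c : α} (h : P.mul a b c) : P.src c = P.src a := by
  obtain ⟨y, h1, h2⟩ := P.assoc (P.src_mul a) h
  obtain rfl := P.mul_unique h h1
  exact (eq_src (P.src_mem a) h2).symm

theorem src_eq_right {a b c : α} (h : P.mul a b c) : P.src c = P.src b :=
  src_eq_left (P.mul_comm h)

/-- This is the Frobenius law for the two factorizations of `a` as `a · src a` and `src a · a`. -/
theorem exists_inv (a : α) : ∃ s, P.mul a s (P.src a) := by
  obtain ⟨s, -, h⟩ := P.frobenius (P.mul_comm (P.src_mul a)) (P.src_mul a)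
  exact ⟨s, h⟩

/-- With `s` inverse to `b`, the product `(s · b) · a` is defined, so by associativity `b · a` is
defined too. -/
theorem exists_mul {a b : α} (h : P.src a = P.src b) : ∃ c, P.mul a b c := by
  obtain ⟨s, hs⟩ := P.exists_inv b
  rw [← h] at hs
  obtain ⟨y, hy, -⟩ := P.assoc (P.mul_comm hs) (P.src_mul a)
  exact ⟨y, P.mul_comm hy⟩

theorem mul_right_cancel {a b s c : α} (ha : P.mul a s c) (hb : P.mul b s c) : a = b := by
  obtain ⟨t, ht⟩ := P.exists_inv s
  have key {a : α} (ha : P.mul a s c) : P.mul t c a := by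
    have h := P.src_mul a
    rw [← src_eq_left ha, src_eq_right ha] at h
    obtain ⟨y, h1, h2⟩ := P.assoc (P.mul_comm ht) h
    rwa [P.mul_unique (P.mul_comm ha) h1]
  exact P.mul_unique (key ha) (key hb)

/-! ### Strongly complementary pairs of groupoids and their coordinates -/

variable (P Q) in
/-- Strong complementarity of two abelian groupoids. -/
structure Complementary : Prop where
  bialgebra (a b c d : α) : (∃ x, Q.mul a b x ∧ P.mul c d x) ↔
    ∃ p q r s, P.mul p q a ∧ P.mul r s b ∧ Q.mul p r c ∧ Q.mul q s d
  unit_copy (a b : α) : (∃ x ∈ Q.ids, P.mul a b x) ↔ a ∈ Q.ids ∧ b ∈ Q.ids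
  counit_copy (a b : α) : (∃ x ∈ P.ids, Q.mul a b x) ↔ a ∈ P.ids ∧ b ∈ P.ids

namespace Complementary

variable (h : Complementary P Q)
include h

/-- Exchanging the groupoids transposes the square array `p q / r s` of the bialgebra equation. -/
theorem symm : Complementary Q P where
  bialgebra a b c d := by
    rw [show (∃ x, P.mul a b x ∧ Q.mul c d x) ↔ ∃ x, Q.mul c d x ∧ P.mul a b x by
      simp only [and_comm], h.bialgebra]
    constructor
    · rintro ⟨p, q, r, s, h1, h2, h3, h4⟩; exact ⟨p, r, q, s, h3, h4, h1, h2⟩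
    · rintro ⟨p, q, r, s, h1, h2, h3, h4⟩; exact ⟨p, r, q, s, h3, h4, h1, h2⟩
  unit_copy := h.counit_copy
  counit_copy := h.unit_copy

theorem exists_mul_mem {a b : α} (ha : a ∈ Q.ids) (hb : b ∈ Q.ids) :
    ∃ c ∈ Q.ids, P.mul a b c := (h.unit_copy a b).2 ⟨ha, hb⟩

theorem mem_left {a b c : α} (hc : c ∈ Q.ids) (hm : P.mul a b c) : a ∈ Q.ids :=
  ((h.unit_copy a b).1 ⟨c, hc, hm⟩).1

theorem mem_right {a b c : α} (hc : c ∈ Q.ids) (hm : P.mul a b c) : b ∈ Q.ids :=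
  ((h.unit_copy a b).1 ⟨c, hc, hm⟩).2

theorem src_mem_ids {a : α} (ha : a ∈ Q.ids) : P.src a ∈ Q.ids := h.mem_left ha (P.src_mul a)

/-- Any two `Q`-identities are `P`-composable. The common source is an origin, an identity of both
groupoids. -/
theorem src_eq_src {a b : α} (ha : a ∈ Q.ids) (hb : b ∈ Q.ids) : P.src a = P.src b := by
  obtain ⟨c, -, hc⟩ := h.exists_mul_mem ha hb
  rw [← src_eq_left hc, src_eq_right hc]

/-- Apply the bialgebra equation to `c = c · Q.src c` in `Q` and `c = a · b` in `P`. The factors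
`r`, `s` of `Q.src c` must be `Q`-identities, hence they are the sources of `a` and `b`. -/
theorem src_hom {a b c : α} (hm : P.mul a b c) : P.mul (Q.src a) (Q.src b) (Q.src c) := by
  obtain ⟨p, q, r, s, h1, h2, h3, h4⟩ :=
    (h.bialgebra c (Q.src c) a b).1 ⟨c, Q.mul_comm (Q.src_mul c), hm⟩
  have hr := h.mem_left (Q.src_mem c) h2
  have hs := h.mem_right (Q.src_mem c) h2
  obtain rfl := Q.eq_of_id_mul hr (Q.mul_comm h3)
  obtain rfl := Q.eq_of_id_mul hs (Q.mul_comm h4)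
  rwa [← eq_src hr (Q.mul_comm h3), ← eq_src hs (Q.mul_comm h4)]

/-- The element `P.src x` is the origin, so the `P`-identities form exactly its `Q`-component. -/
theorem mem_ids_iff {x a : α} (hx : x ∈ Q.ids) : a ∈ P.ids ↔ Q.src a = P.src x := by
  constructor
  · intro ha
    have h1 := h.symm.src_mem_ids ha
    rw [← src_of_mem h1]
    exact h.src_eq_src (Q.src_mem a) hx
  · intro ha
    obtain ⟨s, hs⟩ := Q.exists_inv a
    rw [ha] at hs
    exact h.symm.mem_left (P.src_mem x) hs

/-- The `P`-quotient `c` of `a` by `b` has the `Q`-source of a `P`-identity, because `Q.src` is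
multiplicative. Hence `c` is itself an identity, and cancellation applies. -/
theorem src_injective {a b : α} (hP : P.src a = P.src b) (hQ : Q.src a = Q.src b) : a = b := by
  obtain ⟨s, hs⟩ := P.exists_inv b
  have hbs : P.src b = P.src s := by rw [← src_eq_right hs, src_of_mem (P.src_mem b)]
  obtain ⟨c, hc⟩ := P.exists_mul (hP.trans hbs)
  have h1 := h.src_hom hs
  have h2 := h.src_hom hc
  rw [hQ] at h2
  have h3 := P.mul_unique h1 h2
  have hmem : c ∈ P.ids := by
    rw [h.mem_ids_iff (Q.src_mem b), ← h3, ← h.mem_ids_iff (Q.src_mem b)]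
    exact P.src_mem b
  have h4 : c = P.src b := by rw [← src_of_mem hmem, src_eq_left hc, hP]
  subst h4
  exact P.mul_right_cancel hc hs

/-- The origin is both the `P`-product of `g` with its inverse and the `Q`-product of `k` with its
inverse. The bialgebra equation refines these two factorizations, and the corner `p` is a `P`-factor
of `k` and a `Q`-factor of `g`. -/
theorem src_surjective {g k : α} (hg : g ∈ Q.ids) (hk : k ∈ P.ids) :
    ∃ a, Q.src a = g ∧ P.src a = k := by
  obtain ⟨g', hg'⟩ := P.exists_inv g
  obtain ⟨k', hk'⟩ := Q.exists_inv k
  rw [(h.mem_ids_iff hg).1 hk] at hk'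
  obtain ⟨p, q, r, s, h1, -, h3, -⟩ := (h.bialgebra k k' g g').1 ⟨_, hk', hg'⟩
  refine ⟨p, ?_, ?_⟩
  · rw [← src_eq_left h3, src_of_mem hg]
  · rw [← src_eq_left h1, src_of_mem hk]

/-- The identities of `Q` form an abelian group under the composition of `P`. -/
noncomputable abbrev idsGroup (hne : Q.ids.Nonempty) : AddCommGroup Q.ids :=
  letI add : Add Q.ids :=
    ⟨fun a b => ⟨_, (h.exists_mul_mem a.2 b.2).choose_spec.1⟩⟩
  letI zero : Zero Q.ids := ⟨⟨_, h.src_mem_ids hne.some_mem⟩⟩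
  letI neg : Neg Q.ids :=
    ⟨fun a => ⟨_, h.mem_right (h.src_mem_ids a.2) (P.exists_inv a.1).choose_spec⟩⟩
  have add_spec (a b : Q.ids) : P.mul a.1 b.1 (a + b).1 :=
    (h.exists_mul_mem a.2 b.2).choose_spec.2
  have zero_spec (a : Q.ids) : (0 : Q.ids).1 = P.src a.1 := h.src_eq_src hne.some_mem a.2
  have neg_spec (a : Q.ids) : P.mul a.1 (-a).1 (P.src a.1) := (P.exists_inv a.1).choose_spec
  { AddGroup.ofLeftAxioms
      (fun a b c => by
        obtain ⟨y, h1, h2⟩ := P.assoc (add_spec a b) (add_spec (a + b) c)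
        rw [P.mul_unique h1 (add_spec b c)] at h2
        exact Subtype.ext (P.mul_unique h2 (add_spec a (b + c))))
      (fun a => by
        have h1 := P.src_mul a.1
        rw [← zero_spec a] at h1
        exact Subtype.ext (P.mul_unique (add_spec 0 a) h1))
      (fun a => Subtype.ext <| by
        rw [P.mul_unique (add_spec (-a) a) (P.mul_comm (neg_spec a)), zero_spec a]) with
    add_comm := fun a b =>
      Subtype.ext (P.mul_unique (add_spec a b) (P.mul_comm (add_spec b a))) }

theorem idsGroup_add (hne : Q.ids.Nonempty) (a b : Q.ids) :
    letI := h.idsGroup hne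
    P.mul a.1 b.1 (a + b).1 :=
  (h.exists_mul_mem a.2 b.2).choose_spec.2

theorem idsGroup_zero (hne : Q.ids.Nonempty) {x : α} (hx : x ∈ Q.ids) :
    letI := h.idsGroup hne
    (0 : Q.ids).1 = P.src x :=
  h.src_eq_src hne.some_mem hx

/-- The coordinates of an element: its identities in the two groupoids. -/
noncomputable def coords : α ≃ Q.ids × P.ids :=
  Equiv.ofBijective (fun a => (⟨Q.src a, Q.src_mem a⟩, ⟨P.src a, P.src_mem a⟩)) <| by
    constructor
    · intro a b hab
      simp only [Prod.mk.injEq, Subtype.mk.injEq] at hab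
      exact h.src_injective hab.2 hab.1
    · rintro ⟨⟨g, hg⟩, ⟨k, hk⟩⟩
      obtain ⟨a, rfl, rfl⟩ := h.src_surjective hg hk
      exact ⟨a, rfl⟩

/-- The first coordinate is multiplicative by `src_hom`, the second is constant on `P`-components.
Conversely, elements of one component have a product, which its coordinates determine. -/
theorem mul_iff (hne : Q.ids.Nonempty) (a b c : α) :
    letI := h.idsGroup hne
    P.mul a b c ↔ (h.coords a).2 = (h.coords b).2 ∧
      h.coords c = ((h.coords a).1 + (h.coords b).1, (h.coords a).2) := by
  let := h.idsGroup hne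
  have key {a b c : α} (hm : P.mul a b c) :
      h.coords c = ((h.coords a).1 + (h.coords b).1, (h.coords a).2) := by
    refine Prod.ext (Subtype.ext ?_) (Subtype.ext (src_eq_left hm))
    exact P.mul_unique (h.src_hom hm) (h.idsGroup_add hne ⟨_, Q.src_mem a⟩ ⟨_, Q.src_mem b⟩)
  constructor
  · intro hm
    exact ⟨Subtype.ext ((src_eq_left hm).symm.trans (src_eq_right hm)), key hm⟩
  · rintro ⟨h1, h2⟩
    obtain ⟨c', hc'⟩ := P.exists_mul (congrArg Subtype.val h1 : P.src a = P.src b)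
    rwa [h.coords.injective (h2.trans (key hc').symm)]

theorem mem_ids_iff_coords (hne : Q.ids.Nonempty) (a : α) :
    letI := h.idsGroup hne
    a ∈ P.ids ↔ (h.coords a).1 = 0 := by
  let := h.idsGroup hne
  rw [h.mem_ids_iff hne.some_mem, Subtype.ext_iff, h.idsGroup_zero hne hne.some_mem]
  rfl

end Complementary

end AbelianGroupoid

open DaggerSMC (dagger)

/-! ### Observables in `FRel` as abelian groupoids -/

namespace FRel

variable {A B D E : FRel.{u}}

@[simp] theorem rel_dagger (f : A ⟶ B) (a : A.carrier) (b : B.carrier) :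
    rel (dagger f) b a ↔ rel f a b := Iff.rfl

@[simp] theorem rel_braiding_hom (a a' : A.carrier) (b b' : B.carrier) :
    rel (β_ A B).hom (a, b) (b', a') ↔ a = a' ∧ b = b' := rel_swap_hom a a' b b'

@[simp] theorem rel_tensorμ (a a' : A.carrier) (b b' : B.carrier) (c c' : D.carrier)
    (d d' : E.carrier) :
    rel (tensorμ A B D E) ((a, b), (c, d)) ((a', c'), (b', d')) ↔
      a = a' ∧ b = b' ∧ c = c' ∧ d = d' := by
  simp [tensorμ, and_assoc]
  grind

theorem unit_hom_ext {f g : 𝟙_ FRel.{u} ⟶ A} (h : toSet f = toSet g) : f = g :=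
  hom_ext fun _ a => Set.ext_iff.1 h a

theorem rel_comul (Z : Observable A) (a b c : A.carrier) :
    rel Z.comul c (a, b) ↔ rel Z.mult (a, b) c := Iff.rfl

theorem rel_counit (Z : Observable A) (a : A.carrier) (x : (𝟙_ FRel.{u}).carrier) :
    rel Z.counit a x ↔ a ∈ toSet Z.unit := Iff.rfl

theorem rel_congr {f g : A ⟶ B} (h : f = g) (a : A.carrier) (b : B.carrier) :
    rel f a b ↔ rel g a b := by rw [h]

/-- The abelian groupoid of an observable. -/
def groupoid (Z : Observable A) : AbelianGroupoid A.carrier where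
  mul a b c := rel Z.mult (a, b) c
  ids := toSet Z.unit
  mul_unique {a b c d} h1 h2 := by
    -- Two products of one pair are related by comultiplying and multiplying again, whereas a scalar
    -- multiple of the identity relates only equal elements.
    obtain ⟨N, hN⟩ := Z.quasiSpecial
    have h := (rel_congr hN c d).1 ⟨(a, b), h1, h2⟩
    simp only [rel_comp, exists_tensor, rel_leftUnitor_inv, rel_whiskerRight,
      rel_leftUnitor_hom] at h
    obtain ⟨_, _, rfl, _, _, ⟨_, rfl⟩, rfl⟩ := h
    rfl
  mul_comm {a b c} h := by
    exact (rel_congr Z.commutative (b, a) c).1 ⟨(a, b), rfl, h⟩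
  eq_of_id_mul {x a b} hx h := by
    refine (rel_leftUnitor_hom PUnit.unit a b).1
      ((rel_congr (Z.one_mul) (PUnit.unit, a) b).1 ⟨(x, a), ⟨hx, rfl⟩, h⟩)
  exists_id a := by
    obtain ⟨⟨x, a'⟩, ⟨hx, h1⟩, h2⟩ := (rel_congr (Z.one_mul) (PUnit.unit, a) a).2 rfl
    obtain rfl : a = a' := h1
    exact ⟨x, hx, h2⟩
  assoc {a b c d x} h1 h2 := by
    have h := (rel_congr (Z.mul_assoc) ((a, b), c) d).1 ⟨(x, c), ⟨h1, rfl⟩, h2⟩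
    simp only [rel_comp, exists_tensor, rel_associator_hom, rel_whiskerLeft] at h
    obtain ⟨_, _, _, ⟨rfl, rfl, rfl⟩, _, y, ⟨rfl, hy⟩, h⟩ := h
    exact ⟨y, hy, h⟩
  frobenius {a b c d x} h1 h2 := by
    have h := (rel_congr Z.frobenius_left (a, b) (c, d)).2 ⟨x, h1, h2⟩
    simp only [rel_comp, exists_tensor, rel_associator_inv, rel_whiskerLeft,
      rel_whiskerRight, rel_dagger] at h
    obtain ⟨_, _, _, ⟨rfl, h⟩, _, _, _, ⟨rfl, rfl, rfl⟩, h', rfl⟩ := h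
    exact ⟨_, h, h'⟩

theorem groupoid_complementary {Z X : Observable A} (h : Z.StronglyComplementary X) :
    (groupoid Z).Complementary (groupoid X) where
  bialgebra a b c d := by
    refine (rel_congr h.bialgebra (a, b) (c, d)).trans ?_
    simp only [rel_comp, exists_tensor, rel_tensorHom]
    constructor
    · rintro ⟨p, q, r, s, ⟨h1, h2⟩, _, _, _, _, hμ, h3, h4⟩
      obtain ⟨rfl, rfl, rfl, rfl⟩ := (rel_tensorμ _ _ _ _ _ _ _ _).1 hμ
      exact ⟨p, q, r, s, h1, h2, h3, h4⟩
    · rintro ⟨p, q, r, s, h1, h2, h3, h4⟩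
      exact ⟨p, q, r, s, ⟨h1, h2⟩, p, r, q, s,
        (rel_tensorμ _ _ _ _ _ _ _ _).2 ⟨rfl, rfl, rfl, rfl⟩, h3, h4⟩
  unit_copy a b := by
    refine (rel_congr h.unit_copy PUnit.unit (a, b)).trans ?_
    simp only [rel_comp, exists_tensor, exists_unit, rel_tensorHom]
    exact ⟨fun h => h.2, fun h => ⟨rfl, h⟩⟩
  counit_copy a b := by
    refine Iff.trans ?_ ((rel_congr h.counit_copy (a, b) PUnit.unit).trans ?_)
    · simp only [rel_comp]
      exact exists_congr fun _ => and_comm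
    · simp only [rel_comp, exists_tensor, exists_unit, rel_tensorHom]
      exact ⟨fun h => h.1, fun h => ⟨h, rfl⟩⟩

/-- A strongly complementary pair of observables has the form `(⨁_{h ∈ H} G, ⨁_{g ∈ G} H)`. -/
theorem exists_isSumOfCopies {Z X : Observable A} [hA : Nonempty A.carrier]
    (h : Z.StronglyComplementary X) :
    ∃ (G H : Type u) (_ : AddCommGroup G) (_ : AddCommGroup H) (e : A.carrier ≃ G × H),
      IsSumOfCopies Z e ∧ IsSumOfCopies X (e.trans (Equiv.prodComm G H)) := by
  have hc := groupoid_complementary h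
  have hZ : (groupoid Z).ids.Nonempty := ⟨_, (groupoid Z).src_mem hA.some⟩
  have hX : (groupoid X).ids.Nonempty := ⟨_, (groupoid X).src_mem hA.some⟩
  exact ⟨(groupoid X).ids, (groupoid Z).ids, hc.idsGroup hX, hc.symm.idsGroup hZ, hc.coords,
    ⟨hc.mul_iff hX, Set.ext (hc.mem_ids_iff_coords hX)⟩,
    ⟨hc.symm.mul_iff hZ, Set.ext (hc.symm.mem_ids_iff_coords hZ)⟩⟩

/-! ### Phase states and classical points in coordinates -/

/-- The set `{(γ i, i) | i ∈ I}`, transported along the bijection `e`. -/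
def graph {α K I : Type*} (e : α ≃ K × I) (γ : I → K) : Set α := {a | (e a).1 = γ (e a).2}

theorem mem_graph {α K I : Type*} {e : α ≃ K × I} {γ : I → K} {a : α} :
    a ∈ graph e γ ↔ (e a).1 = γ (e a).2 := Iff.rfl

theorem graph_injective {α K I : Type*} (e : α ≃ K × I) : Function.Injective (graph e) := by
  intro γ γ' h
  funext i
  have : e.symm (γ i, i) ∈ graph e γ' := h ▸ by simp [mem_graph]
  simpa [mem_graph] using this

variable {A : FRel.{u}} {Z : Observable A} {K I : Type*} [AddCommGroup K] {e : A.carrier ≃ K × I}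

/-- The state given by a subset. -/
def stateOf (s : Set A.carrier) : 𝟙_ FRel.{u} ⟶ A := ofRel fun _ a => a ∈ s

theorem mem_toSet_add {j k : 𝟙_ FRel.{u} ⟶ A} {c : A.carrier} :
    c ∈ toSet (Z.add j k) ↔ ∃ a ∈ toSet j, ∃ b ∈ toSet k, rel Z.mult (a, b) c := by
  refine Iff.trans (b := rel (Z.add j k) PUnit.unit c) Iff.rfl ?_
  simp only [Observable.add, rel_comp, exists_tensor, exists_unit, rel_leftUnitor_inv,
    rel_tensorHom]
  constructor
  · rintro ⟨-, a, b, ⟨ha, hb⟩, h⟩; exact ⟨a, ha, b, hb, h⟩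
  · rintro ⟨a, ha, b, hb, h⟩; exact ⟨trivial, a, b, ⟨ha, hb⟩, h⟩

theorem isPhaseState_iff_forall {j : 𝟙_ FRel.{u} ⟶ A} :
    Z.IsPhaseState j ↔ ∀ c, (∃ a ∈ toSet j, ∃ b ∈ toSet j, rel Z.mult (a, c) b) ↔
      c ∈ toSet Z.unit := by
  have key (c : A.carrier) : rel (j ≫ Z.comul ≫ (dagger j ▷ A) ≫ (λ_ A).hom) PUnit.unit c ↔
      ∃ a ∈ toSet j, ∃ b ∈ toSet j, rel Z.mult (a, c) b := by
    simp only [rel_comp, exists_tensor, exists_unit, rel_leftUnitor_hom, rel_whiskerRight,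
      rel_dagger, rel_comul]
    constructor
    · rintro ⟨b, hb, a, _, h, _, ⟨ha, rfl⟩, rfl⟩; exact ⟨a, ha, b, hb, h⟩
    · rintro ⟨a, ha, b, hb, h⟩; exact ⟨b, hb, a, c, h, c, ⟨ha, rfl⟩, rfl⟩
  constructor
  · intro h c
    rw [← key c, rel_congr h]
    rfl
  · intro h
    exact hom_ext fun _ c => (key c).trans (h c)

theorem isClassical_iff_forall {j : 𝟙_ FRel.{u} ⟶ A} :
    Z.IsClassical j ↔
      (∀ a b, (∃ c ∈ toSet j, rel Z.mult (a, b) c) ↔ a ∈ toSet j ∧ b ∈ toSet j) ∧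
      ∃ a ∈ toSet j, a ∈ toSet Z.unit := by
  refine and_congr ⟨fun h a b => ?_, fun h => hom_ext ?_⟩ ⟨fun h => ?_, fun h => hom_ext ?_⟩
  · refine (rel_congr h PUnit.unit (a, b)).trans ?_
    simp only [rel_comp, exists_tensor, exists_unit, rel_tensorHom]
    exact ⟨fun h => h.2, fun h => ⟨rfl, h⟩⟩
  · rintro _ ⟨a, b⟩
    refine (h a b).trans ?_
    simp only [rel_comp, exists_tensor, exists_unit, rel_tensorHom]
    exact ⟨fun h => ⟨rfl, h⟩, fun h => h.2⟩
  · exact (rel_congr h PUnit.unit PUnit.unit).2 rfl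
  · intro _ _
    exact ⟨fun _ => rfl, fun _ => h⟩

namespace IsSumOfCopies

variable (hZ : IsSumOfCopies Z e)
include hZ

theorem rel_mult {a b c : A.carrier} : rel Z.mult (a, b) c ↔
    (e a).2 = (e b).2 ∧ (e c).2 = (e b).2 ∧ (e c).1 = (e a).1 + (e b).1 := by
  rw [hZ.1, Prod.ext_iff]
  grind

theorem mem_unit {a : A.carrier} : a ∈ toSet Z.unit ↔ (e a).1 = 0 := by
  rw [hZ.2]; rfl

/-- The quotients of elements of `j` within a component have to be exactly the identities. That
every identity occurs means `j` meets each component; that nothing else occurs means it does so only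
once. -/
theorem isPhaseState_iff {j : 𝟙_ FRel.{u} ⟶ A} :
    Z.IsPhaseState j ↔ ∃ γ : I → K, toSet j = graph e γ := by
  simp only [isPhaseState_iff_forall, hZ.rel_mult, hZ.mem_unit]
  constructor
  · intro h
    have hex (i : I) : ∃ k, e.symm (k, i) ∈ toSet j := by
      obtain ⟨a, ha, -, -, h1, -⟩ := (h (e.symm (0, i))).2 (by simp)
      refine ⟨(e a).1, ?_⟩
      obtain rfl : (e a).2 = i := by simpa using h1
      rwa [Prod.mk.eta, e.symm_apply_apply]
    choose γ hγ using hex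
    refine ⟨γ, Set.ext fun a => ?_⟩
    rw [mem_graph]
    constructor
    · intro ha
      have := (h (e.symm ((e a).1 - γ (e a).2, (e a).2))).1 ⟨_, hγ (e a).2, a, ha, by simp⟩
      simpa [sub_eq_zero] using this
    · intro ha
      have := hγ (e a).2
      rwa [← ha, Prod.mk.eta, e.symm_apply_apply] at this
  · rintro ⟨γ, h⟩ c
    rw [h]
    constructor
    · rintro ⟨a, ha, b, hb, h1, h2, h3⟩
      rw [mem_graph] at ha hb
      rw [hb, ha, h2, h1] at h3
      simpa using h3
    · intro hc
      refine ⟨e.symm (γ (e c).2, (e c).2), ?_, e.symm (γ (e c).2, (e c).2), ?_, ?_⟩ <;>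
        simp [mem_graph, hc]

/-- The counit condition puts an identity `a` into `j`. Copying forces elements of `j` to be
composable with `a`, and conversely any `b` in the component of `a` lies in `j`, being a factor of
`a = b · b⁻¹`. -/
theorem isClassical_iff {j : 𝟙_ FRel.{u} ⟶ A} :
    Z.IsClassical j ↔ ∃ i, toSet j = {a | (e a).2 = i} := by
  simp only [isClassical_iff_forall, hZ.rel_mult, hZ.mem_unit]
  constructor
  · rintro ⟨h1, a, ha, ha0⟩
    refine ⟨(e a).2, Set.ext fun b => ⟨fun hb => ?_, fun hb => ?_⟩⟩
    · obtain ⟨_, -, h, -⟩ := (h1 b a).2 ⟨hb, ha⟩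
      exact h
    · refine ((h1 b (e.symm (-(e b).1, (e a).2))).1 ⟨a, ha, ?_⟩).1
      simpa [ha0] using hb
  · rintro ⟨i, h⟩
    rw [h]
    refine ⟨fun a b => ⟨?_, ?_⟩, e.symm (0, i), by simp, by simp⟩
    · rintro ⟨c, rfl, h1, h2, -⟩
      exact ⟨h1.trans h2.symm, h2.symm⟩
    · rintro ⟨ha, hb⟩
      refine ⟨e.symm ((e a).1 + (e b).1, i), ?_⟩
      simp_all

theorem toSet_add {j k : 𝟙_ FRel.{u} ⟶ A} {γ δ : I → K} (hj : toSet j = graph e γ)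
    (hk : toSet k = graph e δ) : toSet (Z.add j k) = graph e (γ + δ) := by
  ext c
  rw [mem_toSet_add, hj, hk]
  simp only [hZ.rel_mult, mem_graph]
  constructor
  · rintro ⟨a, ha, b, hb, h1, h2, h3⟩
    rw [h3, ha, hb, h1, h2]
    rfl
  · intro hc
    exact ⟨e.symm (γ (e c).2, (e c).2), by simp, e.symm (δ (e c).2, (e c).2), by simp,
      by simp [hc]⟩

theorem toSet_unit : toSet Z.unit = graph e 0 := hZ.2

theorem toSet_sum (n : ℕ) (a : Fin n → (𝟙_ FRel.{u} ⟶ A)) (γ : Fin n → I → K)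
    (h : ∀ i, toSet (a i) = graph e (γ i)) : toSet (Z.sum n a) = graph e (∑ i, γ i) := by
  induction n with
  | zero => rw [Fin.sum_univ_zero]; exact hZ.toSet_unit
  | succ n ih =>
    rw [Fin.sum_univ_succ]
    exact hZ.toSet_add (h 0) (ih _ _ fun i => h i.succ)

/-- Phase states correspond to functions from the set of components to the group. -/
noncomputable def phaseEquiv : Z.PhaseState ≃ (I → K) where
  toFun α := (hZ.isPhaseState_iff.1 α.isPhaseState).choose
  invFun γ := ⟨stateOf (graph e γ), hZ.isPhaseState_iff.2 ⟨γ, rfl⟩⟩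
  left_inv α := Observable.PhaseState.ext <| unit_hom_ext
    (hZ.isPhaseState_iff.1 α.isPhaseState).choose_spec.symm
  right_inv γ := graph_injective e <| by
    generalize_proofs h
    exact (h _).choose_spec.symm

theorem toSet_state (α : Z.PhaseState) : toSet α.state = graph e (hZ.phaseEquiv α) :=
  (hZ.isPhaseState_iff.1 α.isPhaseState).choose_spec

/-- The group of phase states. -/
noncomputable abbrev phaseGroup : AddCommGroup Z.PhaseState := hZ.phaseEquiv.addCommGroup

/-- The group of phase states is isomorphic to a power of the group. -/
noncomputable def phaseAddEquiv :
    letI := hZ.phaseGroup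
    Z.PhaseState ≃+ (I → K) :=
  letI := hZ.phaseGroup
  { hZ.phaseEquiv with map_add' := fun _ _ => hZ.phaseEquiv.apply_symm_apply _ }

theorem phaseGroup_add (α β : Z.PhaseState) :
    letI := hZ.phaseGroup
    (α + β).state = Z.add α.state β.state := by
  let := hZ.phaseGroup
  refine unit_hom_ext ?_
  rw [hZ.toSet_add (hZ.toSet_state α) (hZ.toSet_state β), hZ.toSet_state]
  exact congrArg _ (hZ.phaseAddEquiv.map_add α β)

end IsSumOfCopies

end FRel

/-! ### Algebraic extensions of the constant vectors -/

/-- The constant vectors in a power of a group have no proper algebraic extensions inside it. -/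
theorem trivialAlgebraicExtension_of_constants {P G H : Type*} [AddCommGroup P] [AddCommGroup G]
    (i : H) (Φ : P ≃+ (H → G)) (K : AddSubgroup P)
    (hK : ∀ a, a ∈ K ↔ ∃ g : G, ∀ h, Φ a h = g) : TrivialAlgebraicExtension K := by
  rintro ⟨l, m, n, k, ⟨x, hx⟩, hno⟩
  -- Each unknown is replaced by the constant vector of its `i`-th entry; this operation is a
  -- homomorphism that fixes the right-hand sides.
  refine hno ⟨fun j => ⟨Φ.symm fun _ => Φ (x j) i, (hK _).2 ⟨Φ (x j) i, by simp⟩⟩, fun p => ?_⟩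
  obtain ⟨g, hg⟩ := (hK _).1 (k p).2
  refine Subtype.ext (Φ.injective (funext fun h => ?_))
  have h1 := congrFun (congrArg Φ (hx p)) i
  rw [hg] at h1 ⊢
  simpa [map_sum] using h1

/-! ### Tensor powers, wire by wire -/

namespace FRel

variable {A : FRel.{u}}

/-- The elements on the individual wires. -/
def wires : (n : ℕ) → (pow A n).carrier → Fin n → A.carrier
  | 0, _ => Fin.elim0
  | n + 1, x => Fin.cons (Prod.fst x) (wires n (Prod.snd x))

/-- An element of a tensor power with given elements on the individual wires. -/
def ofWires : (n : ℕ) → (Fin n → A.carrier) → (pow A n).carrier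
  | 0, _ => PUnit.unit
  | n + 1, x => (x 0, ofWires n fun i => x i.succ)

@[simp] theorem wires_ofWires (n : ℕ) (x : Fin n → A.carrier) : wires n (ofWires n x) = x := by
  induction n with
  | zero => exact funext fun i => i.elim0
  | succ n ih =>
    refine funext (Fin.cases rfl fun i => ?_)
    exact congrFun (ih fun i => x i.succ) i

@[simp] theorem wires_succ_zero {n : ℕ} (a : A.carrier) (x : (pow A n).carrier) :
    wires (n + 1) (a, x) 0 = a := rfl

@[simp] theorem wires_succ_succ {n : ℕ} (a : A.carrier) (x : (pow A n).carrier) (i : Fin n) :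
    wires (n + 1) (a, x) i.succ = wires n x i := rfl

theorem rel_powMap (n : ℕ) (f : Fin n → (A ⟶ A)) (x y : (pow A n).carrier) :
    rel (powMap n f) x y ↔ ∀ i, rel (f i) (wires n x i) (wires n y i) := by
  induction n with
  | zero => exact ⟨fun _ i => i.elim0, fun _ => rfl⟩
  | succ n ih =>
    obtain ⟨a, x⟩ := x
    obtain ⟨b, y⟩ := y
    simp only [Fin.forall_fin_succ, wires_succ_zero, wires_succ_succ]
    exact and_congr Iff.rfl (ih _ x y)

theorem rel_comulPow (Z : Observable A) (n : ℕ) (x y z : (pow A n).carrier) :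
    rel (Z.comulPow n) x (y, z) ↔ ∀ i, rel Z.mult (wires n y i, wires n z i) (wires n x i) := by
  induction n with
  | zero => exact ⟨fun _ i => i.elim0, fun _ => rfl⟩
  | succ n ih =>
    obtain ⟨a, x⟩ := x
    obtain ⟨b, y⟩ := y
    obtain ⟨c, z⟩ := z
    simp only [Fin.forall_fin_succ, wires_succ_zero, wires_succ_succ, ← ih]
    change rel ((Z.comul ⊗ₘ Z.comulPow n) ≫ tensorμ A A (pow A n) (pow A n)) (a, x)
      ((b, y), (c, z)) ↔ _
    simp only [rel_comp, exists_tensor, rel_tensorHom]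
    constructor
    · rintro ⟨_, _, _, _, ⟨h1, h2⟩, hμ⟩
      obtain ⟨rfl, rfl, rfl, rfl⟩ := (rel_tensorμ _ _ _ _ _ _ _ _).1 hμ
      exact ⟨h1, h2⟩
    · rintro ⟨h1, h2⟩
      exact ⟨b, c, y, z, ⟨h1, h2⟩, (rel_tensorμ _ _ _ _ _ _ _ _).2 ⟨rfl, rfl, rfl, rfl⟩⟩

theorem rel_counitPow (Z : Observable A) (n : ℕ) (x : (pow A n).carrier)
    (t : (𝟙_ FRel.{u}).carrier) :
    rel (Z.counitPow n) x t ↔ ∀ i, wires n x i ∈ toSet Z.unit := by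
  induction n with
  | zero => exact ⟨fun _ i => i.elim0, fun _ => rfl⟩
  | succ n ih =>
    obtain ⟨a, x⟩ := x
    simp only [Fin.forall_fin_succ, wires_succ_zero, wires_succ_succ, ← ih]
    change rel ((Z.counit ⊗ₘ Z.counitPow n) ≫ (λ_ (𝟙_ FRel)).hom) (a, x) t ↔ _
    simp only [rel_comp, exists_tensor, rel_tensorHom, exists_unit]
    exact ⟨fun h => h.1, fun h => ⟨h, rfl⟩⟩

theorem rel_proj (Z : Observable A) (n : ℕ) (i : Fin n) (x : (pow A n).carrier) (a : A.carrier) :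
    rel (Z.proj n i) x a ↔ wires n x i = a ∧ ∀ j ≠ i, wires n x j ∈ toSet Z.unit := by
  induction n with
  | zero => exact i.elim0
  | succ n ih =>
    obtain ⟨b, x⟩ := x
    induction i using Fin.cases with
    | zero =>
      change rel ((A ◁ Z.counitPow n) ≫ (ρ_ A).hom) (b, x) a ↔ _
      simp only [rel_comp, exists_tensor, rel_whiskerLeft, exists_unit, rel_counitPow,
        rel_rightUnitor_hom, Fin.forall_fin_succ, wires_succ_zero, wires_succ_succ]
      constructor
      · rintro ⟨_, ⟨rfl, h⟩, rfl⟩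
        exact ⟨rfl, fun h => absurd rfl h, fun i _ => h i⟩
      · rintro ⟨rfl, -, h⟩
        exact ⟨b, ⟨rfl, fun i => h i (Fin.succ_ne_zero i)⟩, rfl⟩
    | succ i =>
      change rel ((Z.counit ▷ pow A n) ≫ (λ_ (pow A n)).hom ≫ Z.proj n i) (b, x) a ↔ _
      simp only [rel_comp, exists_tensor, rel_whiskerRight, exists_unit, rel_counit,
        rel_leftUnitor_hom, Fin.forall_fin_succ, wires_succ_zero, wires_succ_succ]
      constructor
      · rintro ⟨_, ⟨h, rfl⟩, _, rfl, h'⟩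
        obtain ⟨h1, h2⟩ := (ih i x).1 h'
        exact ⟨h1, fun _ => h, fun j hj => h2 j fun hji => hj (congrArg _ hji)⟩
      · rintro ⟨h1, h2, h3⟩
        exact ⟨x, ⟨h2 (Fin.succ_ne_zero i).symm, rfl⟩, x, rfl, (ih i x).2
          ⟨h1, fun j hj => h3 j fun hji => hj (Fin.succ_injective _ hji)⟩⟩

/-! ### Spiders, phases and wirings in coordinates -/

namespace IsSumOfCopies

variable {Z X : Observable A}

section Single

variable {K I : Type*} [AddCommGroup K] {e : A.carrier ≃ K × I} (hZ : IsSumOfCopies Z e)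
include hZ

theorem rel_spider (n : ℕ) (a : A.carrier) (x : (pow A n).carrier) :
    rel (Z.spider n) a x ↔ (∀ i, (e (wires n x i)).2 = (e a).2) ∧
      (e a).1 = ∑ i, (e (wires n x i)).1 := by
  induction n generalizing a with
  | zero =>
    refine hZ.mem_unit.trans ?_
    simp
  | succ n ih =>
    obtain ⟨b, x⟩ := x
    simp only [Fin.forall_fin_succ, Fin.sum_univ_succ, wires_succ_zero, wires_succ_succ]
    change rel (Z.comul ≫ (A ◁ Z.spider n)) a (b, x) ↔ _
    simp only [rel_comp, exists_tensor, rel_whiskerLeft, rel_comul, hZ.rel_mult, ih]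
    constructor
    · rintro ⟨_, c, ⟨h1, h2, h3⟩, rfl, h4, h5⟩
      exact ⟨⟨h1.trans h2.symm, fun i => (h4 i).trans h2.symm⟩, by rw [h3, h5]⟩
    · rintro ⟨⟨h1, h2⟩, h3⟩
      exact ⟨b, e.symm (∑ i, (e (wires n x i)).1, (e a).2), by simp [h1, h2, h3]⟩

theorem rel_phaseMap {a : 𝟙_ FRel.{u} ⟶ A} {γ : I → K} (ha : toSet a = graph e γ)
    (x y : A.carrier) :
    rel (Z.phaseMap a) x y ↔ (e y).2 = (e x).2 ∧ (e y).1 = (e x).1 + γ (e x).2 := by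
  simp only [Observable.phaseMap, rel_comp, exists_tensor, exists_unit, rel_rightUnitor_inv,
    rel_whiskerLeft]
  constructor
  · rintro ⟨_, rfl, _, b, ⟨rfl, hb⟩, h⟩
    replace hb : b ∈ graph e γ := ha ▸ hb
    obtain ⟨h1, h2, h3⟩ := hZ.rel_mult.1 h
    rw [h3, h2, h1, hb]
    exact ⟨rfl, rfl⟩
  · rintro ⟨h1, h2⟩
    refine ⟨x, rfl, x, e.symm (γ (e x).2, (e x).2), ⟨rfl, ?_⟩, hZ.rel_mult.2 ?_⟩
    · change _ ∈ toSet a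
      simp [ha, mem_graph]
    · simp [h1, h2]

/-- Each node asks that its output legs lie in the component of its input and sum to it; for a node
without legs the empty sum gives the counit. -/
theorem rel_wiring (m n : ℕ) (f : Fin n → Fin m) (x : (pow A m).carrier)
    (y : (pow A n).carrier) :
    rel (Z.wiring m n f) x y ↔ ∀ i,
      (∀ k, f k = i → (e (wires n y k)).2 = (e (wires m x i)).2) ∧
      (e (wires m x i)).1 = ∑ k, if f k = i then (e (wires n y k)).1 else 0 := by
  induction n generalizing x with
  | zero =>
    refine (rel_counitPow Z m x y).trans (forall_congr' fun i => ?_)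
    simp [hZ.mem_unit]
  | succ n ih =>
    obtain ⟨b, y⟩ := y
    simp only [Fin.forall_fin_succ, Fin.sum_univ_succ, wires_succ_zero, wires_succ_succ]
    change rel (Z.comulPow m ≫ (Z.proj m (f 0) ⊗ₘ Z.wiring m n fun k => f k.succ)) x (b, y) ↔ _
    simp only [rel_comp, exists_tensor, rel_tensorHom, rel_comulPow, hZ.rel_mult, rel_proj, ih,
      hZ.mem_unit]
    constructor
    · rintro ⟨p, q, h, ⟨rfl, hp⟩, hq⟩ i
      obtain ⟨h1, h2, h3⟩ := h i
      obtain ⟨h4, h5⟩ := hq i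
      refine ⟨⟨?_, fun k hk => (h4 k hk).trans h2.symm⟩, ?_⟩
      · rintro rfl
        exact h1.trans h2.symm
      · rw [h3, h5]
        split_ifs with hi
        · rw [hi]
        · rw [hp i (Ne.symm hi)]
    · intro h
      -- The copy from which wire `f 0` is kept must carry identities on all other wires; the second
      -- copy carries what the remaining legs sum to.
      refine ⟨ofWires m fun i => if f 0 = i then b else e.symm (0, (e (wires m x i)).2),
        ofWires m fun i => e.symm (∑ k : Fin n, if f k.succ = i then (e (wires n y k)).1 else 0,
          (e (wires m x i)).2), fun i => ?_, ⟨by simp, fun j hj => ?_⟩, fun i => ?_⟩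
      · obtain ⟨⟨h1, h2⟩, h3⟩ := h i
        by_cases hi : f 0 = i
        · simp [hi, h3, h1 hi]
        · simp [hi, h3]
      · simp [hj.symm]
      · simpa using (h i).1.2

end Single

/-! ### Mermin measurements and hidden variables -/

variable {G H : Type*} [AddCommGroup G] [AddCommGroup H] {e : A.carrier ≃ G × H}
  (hZ : IsSumOfCopies Z e) (hX : IsSumOfCopies X (e.trans (Equiv.prodComm G H)))
include hZ

-- On the component `k` the phases shift the sum of the `G`-coordinates by `∑ i, γ i k`. Since this
-- is `g` for every `k`, only the total phase remains visible.
omit [AddCommGroup H] in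
theorem rel_ghz_powMap (n : ℕ) (a : Fin n → (𝟙_ FRel.{u} ⟶ A)) (γ : Fin n → H → G) (g : G)
    (ha : ∀ i, toSet (a i) = graph e (γ i)) (hg : ∀ h, ∑ i, γ i h = g) (x : (pow A n).carrier) :
    rel (Z.ghz n ≫ powMap n fun i => Z.phaseMap (a i)) PUnit.unit x ↔
      (∃ k, ∀ i, (e (wires n x i)).2 = k) ∧ ∑ i, (e (wires n x i)).1 = g := by
  simp only [Observable.ghz, rel_comp, hZ.rel_spider, rel_powMap, fun i => hZ.rel_phaseMap (ha i)]
  constructor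
  · rintro ⟨y, ⟨b, hb, h1, h2⟩, h3⟩
    refine ⟨⟨(e b).2, fun i => (h3 i).1.trans (h1 i)⟩, ?_⟩
    rw [hZ.mem_unit.1 hb] at h2
    simp only [(h3 _).2, h1, Finset.sum_add_distrib, ← h2, hg, zero_add]
  · rintro ⟨⟨k, hk⟩, h⟩
    -- The preimage under the phases, taken in the component `k`.
    refine ⟨ofWires n fun i => e.symm ((e (wires n x i)).1 - γ i k, k), ⟨e.symm (0, k), ?_, ?_⟩, ?_⟩
    · exact hZ.mem_unit.2 (by simp)
    · simp [h, hg]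
    · simp [hk]

include hX

/-- Measuring takes `X`-quotients of elements of `ψ`: these keep the `G`-coordinates and subtract
the `H`-coordinates, which are constant along each tuple. Quotients by tuples with `H`-coordinate
`0` give back all of `ψ`. -/
theorem mem_merminMeasurement (n : ℕ) (a : Fin n → (𝟙_ FRel.{u} ⟶ A)) (γ : Fin n → H → G) (g : G)
    (ha : ∀ i, toSet (a i) = graph e (γ i)) (hg : ∀ h, ∑ i, γ i h = g) (x : (pow A n).carrier) :
    x ∈ toSet (Z.merminMeasurement X n a) ↔
      (∃ k, ∀ i, (e (wires n x i)).2 = k) ∧ ∑ i, (e (wires n x i)).1 = g := by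
  have hψ := hZ.rel_ghz_powMap n a γ g ha hg
  set ψ := Z.ghz n ≫ powMap n fun i => Z.phaseMap (a i)
  have key : x ∈ toSet (Z.merminMeasurement X n a) ↔ ∃ y, rel ψ PUnit.unit y ∧
      ∃ z, rel ψ PUnit.unit z ∧ rel (X.comulPow n) y (z, x) := by
    refine Iff.trans (b := rel (ψ ≫ X.comulPow n ≫ (dagger ψ ▷ pow A n) ≫ (λ_ (pow A n)).hom)
      PUnit.unit x) Iff.rfl ?_
    simp only [rel_comp, exists_tensor, exists_unit, rel_leftUnitor_hom, rel_whiskerRight,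
      rel_dagger]
    constructor
    · rintro ⟨y, hy, z, _, h, _, ⟨hz, rfl⟩, rfl⟩; exact ⟨y, hy, z, hz, h⟩
    · rintro ⟨y, hy, z, hz, h⟩; exact ⟨y, hy, z, x, h, x, ⟨hz, rfl⟩, rfl⟩
  simp only [key, hψ, rel_comulPow, hX.rel_mult, Equiv.trans_apply, Equiv.prodComm_apply,
    Prod.fst_swap, Prod.snd_swap]
  constructor
  · rintro ⟨y, ⟨⟨k, hk⟩, hy⟩, z, ⟨⟨l, hl⟩, hz⟩, h⟩
    refine ⟨⟨k - l, fun i => ?_⟩, ?_⟩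
    · rw [← hk i, ← hl i, (h i).2.2]
      abel
    · rw [← hz]
      exact Finset.sum_congr rfl fun i _ => (h i).1.symm
  · rintro ⟨hx, h⟩
    refine ⟨x, ⟨hx, h⟩, ofWires n fun i => e.symm ((e (wires n x i)).1, 0), ⟨⟨0, ?_⟩, ?_⟩, ?_⟩ <;>
      simp [h]

omit [AddCommGroup G] hZ in
theorem rel_restrict (𝒮 : Observable.Scenario Z X) (s : Fin 𝒮.S)
    (b : (pow A (𝒮.S * 𝒮.N)).carrier) (y : (pow A 𝒮.N).carrier) :
    rel (𝒮.restrict s) b y ↔ ∀ t j,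
      if t = s then wires _ b (finProdFinEquiv (t, j)) = wires _ y j
      else (e (wires _ b (finProdFinEquiv (t, j)))).2 = 0 := by
  refine (hX.rel_wiring _ _ _ b y).trans ?_
  rw [← finProdFinEquiv.forall_congr_right, Prod.forall]
  refine forall₂_congr fun t j => ?_
  simp only [Equiv.trans_apply, Equiv.prodComm_apply, Prod.fst_swap, Prod.snd_swap,
    EmbeddingLike.apply_eq_iff_eq, Prod.mk.injEq]
  split_ifs with h
  · subst h
    simp only [true_and, forall_eq, Finset.sum_ite_eq', Finset.mem_univ, if_true]
    rw [← e.injective.eq_iff, Prod.ext_iff]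
    exact and_congr_left' eq_comm
  · simp [Ne.symm h]

omit [AddCommGroup G] hZ in
theorem rel_localMap (𝒮 : Observable.Scenario Z X)
    (x : (pow A (𝒮.N * 𝒮.M)).carrier) (b : (pow A (𝒮.S * 𝒮.N)).carrier) :
    rel 𝒮.localMap x b ↔ ∀ i r,
      (∀ t, 𝒮.setting t i = r → (e (wires _ b (finProdFinEquiv (t, i)))).1 =
        (e (wires _ x (finProdFinEquiv (i, r)))).1) ∧
      (e (wires _ x (finProdFinEquiv (i, r)))).2 =
        ∑ t, if 𝒮.setting t i = r then (e (wires _ b (finProdFinEquiv (t, i)))).2 else 0 := by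
  refine (hX.rel_wiring _ _ _ x b).trans ?_
  rw [← finProdFinEquiv.forall_congr_right, Prod.forall]
  refine forall₂_congr fun i r => ?_
  simp only [Equiv.trans_apply, Equiv.prodComm_apply, Prod.fst_swap, Prod.snd_swap,
    EmbeddingLike.apply_eq_iff_eq, Prod.mk.injEq]
  rw [← finProdFinEquiv.forall_congr_right, ← Equiv.sum_comp finProdFinEquiv,
    Fintype.sum_prod_type]
  simp only [Equiv.symm_apply_apply, Prod.forall]
  refine and_congr ⟨fun h t ht => h t i ⟨rfl, ht⟩, ?_⟩ (Eq.congr_right ?_)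
  · rintro h t _ ⟨rfl, ht⟩
    exact h t ht
  · refine Finset.sum_congr rfl fun t _ => ?_
    rw [Finset.sum_eq_single i (fun j _ hj => if_neg fun h => hj h.1) (by simp)]
    simp

-- The `X`-counits on the other measurements impose `H`-coordinate `0` and leave the `G`-coordinate
-- free, so only the wires used by measurement `s` may carry a nonzero `H`-coordinate.
omit [AddCommGroup G] hZ in
theorem rel_localMap_restrict (𝒮 : Observable.Scenario Z X) (s : Fin 𝒮.S)
    (x : (pow A (𝒮.N * 𝒮.M)).carrier) (y : (pow A 𝒮.N).carrier) :
    rel (𝒮.localMap ≫ 𝒮.restrict s) x y ↔ ∀ i r,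
      if 𝒮.setting s i = r then wires _ x (finProdFinEquiv (i, r)) = wires _ y i
      else (e (wires _ x (finProdFinEquiv (i, r)))).2 = 0 := by
  simp only [rel_comp, hX.rel_restrict, hX.rel_localMap]
  constructor
  · rintro ⟨b, h1, h2⟩ i r
    obtain ⟨h3, h4⟩ := h1 i r
    have hs := h2 s i
    rw [if_pos rfl] at hs
    rw [Finset.sum_eq_single s (fun t _ ht => ?_) (by simp)] at h4
    · split_ifs at h4 ⊢ with hr
      · rw [← hs]
        exact e.injective (Prod.ext (h3 s hr).symm h4)
      · exact h4
    · have := h2 t i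
      rw [if_neg ht] at this
      simp [this]
  · intro h
    -- Outside block `s` the output copies the `G`-coordinate of its input wire and is an
    -- `X`-identity.
    refine ⟨ofWires _ fun k => if (finProdFinEquiv.symm k).1 = s
      then wires _ y (finProdFinEquiv.symm k).2
      else e.symm ((e (wires _ x (finProdFinEquiv ((finProdFinEquiv.symm k).2,
        𝒮.setting (finProdFinEquiv.symm k).1 (finProdFinEquiv.symm k).2)))).1, 0),
      fun i r => ?_, fun t j => ?_⟩
    · simp only [wires_ofWires, Equiv.symm_apply_apply]
      have hr := h i r
      constructor
      · rintro t rfl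
        split_ifs with ht
        · subst ht
          rw [if_pos rfl] at hr
          rw [hr]
        · simp
      · rw [Finset.sum_eq_single s (fun t _ ht => by simp [ht]) (by simp), if_pos rfl]
        split_ifs at hr ⊢ with hs
        · rw [hr]
        · exact hr
    · simp only [wires_ofWires, Equiv.symm_apply_apply]
      split_ifs <;> simp

theorem hasLocalHiddenVariableModel (𝒮 : Observable.Scenario Z X) :
    𝒮.HasLocalHiddenVariableModel := by
  have hphase (r : Fin 𝒮.M) := hZ.toSet_state (𝒮.phase r)
  set γ : Fin 𝒮.M → H → G := fun r => hZ.phaseEquiv (𝒮.phase r)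
  have hclass (s : Fin 𝒮.S) : ∃ g : G, ∀ h, ∑ i, γ (𝒮.setting s i) h = g := by
    obtain ⟨g, hg⟩ := hX.isClassical_iff.1 (𝒮.classical s)
    rw [hZ.toSet_sum _ _ _ fun i => hphase (𝒮.setting s i)] at hg
    have := graph_injective e (a₂ := fun _ => g) hg
    exact ⟨g, fun h => by rw [← congrFun this h, Finset.sum_apply]⟩
  choose g hg using hclass
  have hmem (s : Fin 𝒮.S) := hZ.mem_merminMeasurement hX 𝒮.N _ _ (g s)
    (fun i => hphase (𝒮.setting s i)) (hg s)
  -- The largest candidate: all hidden values that never produce a wrong outcome. It remains to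
  -- reach every correct outcome.
  refine ⟨stateOf {x | ∀ t y, rel (𝒮.localMap ≫ 𝒮.restrict t) x y →
    y ∈ toSet (𝒮.measurement t)}, fun s => unit_hom_ext (Set.ext fun y => ?_)⟩
  rw [Category.assoc]
  refine ⟨fun ⟨x, hx, hy⟩ => hx s y hy, fun hy => ?_⟩
  obtain ⟨⟨k, hk⟩, hy⟩ := (hmem s y).1 hy
  have hd : ∑ i, ((e (wires _ y i)).1 - γ (𝒮.setting s i) 0) = 0 := by
    rw [Finset.sum_sub_distrib, hy, hg, sub_self]
  -- The wire `(i, r)` gets the `G`-coordinate `γ r 0`, shifted by the deviation of `y` at `i` from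
  -- `γ (𝒮.setting s i) 0`. The deviations sum to zero, so the sum is right for every measurement.
  -- Only the wires that `s` uses carry `k`.
  refine ⟨ofWires _ fun q => e.symm
    (γ (finProdFinEquiv.symm q).2 0 + ((e (wires _ y (finProdFinEquiv.symm q).1)).1 -
      γ (𝒮.setting s (finProdFinEquiv.symm q).1) 0),
    if 𝒮.setting s (finProdFinEquiv.symm q).1 = (finProdFinEquiv.symm q).2 then k else 0),
    fun t z hz => ?_, ?_⟩
  · rw [hX.rel_localMap_restrict] at hz
    simp only [wires_ofWires, Equiv.symm_apply_apply, Equiv.apply_symm_apply] at hz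
    refine (hmem t z).2 ⟨?_, ?_⟩
    · by_cases hk0 : k = 0
      · refine ⟨0, fun i => ?_⟩
        have := hz i (𝒮.setting t i)
        rw [if_pos rfl] at this
        rw [← this]
        simp [hk0]
      -- If `k ≠ 0`, a wire used by `s` but not by `t` cannot be discarded. So an outcome of `t`
      -- exists only if `t` has the same settings as `s`.
      · refine ⟨k, fun i => ?_⟩
        have hts : 𝒮.setting t i = 𝒮.setting s i := by
          by_contra hne
          have := hz i (𝒮.setting s i)
          rw [if_neg hne] at this
          exact hk0 (by simpa using this)
        have := hz i (𝒮.setting t i)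
        rw [if_pos rfl] at this
        rw [← this]
        simp [hts]
    · have hz' (i : Fin 𝒮.N) : (e (wires _ z i)).1 = γ (𝒮.setting t i) 0 +
          ((e (wires _ y i)).1 - γ (𝒮.setting s i) 0) := by
        have := hz i (𝒮.setting t i)
        rw [if_pos rfl] at this
        rw [← this, e.apply_symm_apply]
      simp only [hz']
      rw [Finset.sum_add_distrib, hd, hg, add_zero]
  · refine (hX.rel_localMap_restrict 𝒮 s _ y).2 fun i r => ?_
    simp only [wires_ofWires, Equiv.symm_apply_apply]
    split_ifs with hr
    · subst hr
      rw [Equiv.symm_apply_eq]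
      exact Prod.ext (by simp) (hk i).symm
    · simp

end IsSumOfCopies

/-- Even for zero parties the measurement state is empty, because the GHZ state factors through the
unit state of `A`. -/
theorem hasLocalHiddenVariableModel_of_isEmpty [IsEmpty A.carrier] {Z X : Observable A}
    (𝒮 : Observable.Scenario Z X) : 𝒮.HasLocalHiddenVariableModel := by
  refine ⟨stateOf ∅, fun s => hom_ext fun _ y => iff_of_false ?_ ?_⟩
  · rintro ⟨_, ⟨_, h, -⟩, -⟩
    exact h
  · rintro ⟨_, ⟨_, ⟨a, -⟩, -⟩, -⟩
    exact isEmptyElim a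

theorem merminLocal : MerminLocal FRel.{u} := by
  rintro ⟨A, Z, X, h, 𝒮, h𝒮⟩
  refine h𝒮 ?_
  cases isEmpty_or_nonempty A.carrier
  · exact hasLocalHiddenVariableModel_of_isEmpty 𝒮
  · obtain ⟨G, H, _, _, e, hZ, hX⟩ := exists_isSumOfCopies h
    exact hZ.hasLocalHiddenVariableModel hX 𝒮

end FRel

end Mermin

theorem mainTheorem3 :
    (∀ (A : Mermin.FRel.{u}) (Z X : Mermin.Observable A), Nonempty A.carrier →
      Z.StronglyComplementary X →
      ∃ (G H : Type u) (_ : AddCommGroup G) (_ : AddCommGroup H) (e : A.carrier ≃ G × H),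
        -- the pair has the form `(⨁_{h ∈ H} G, ⨁_{g ∈ G} H)`
        Mermin.FRel.IsSumOfCopies Z e ∧
        Mermin.FRel.IsSumOfCopies X (e.trans (Equiv.prodComm G H)) ∧
        -- the `Z`-phase states are the sets `{(γ h, h) | h ∈ H}` for `γ : H → G`
        (∀ j : 𝟙_ Mermin.FRel.{u} ⟶ A, Z.IsPhaseState j ↔
          ∃ γ : H → G, Mermin.FRel.toSet j = {a | (e a).1 = γ (e a).2}) ∧
        -- the `X`-classical points are the sets `{(g, h) | h ∈ H}` for `g ∈ G`
        (∀ j : 𝟙_ Mermin.FRel.{u} ⟶ A, X.IsClassical j ↔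
          ∃ g : G, Mermin.FRel.toSet j = {a | (e a).1 = g}) ∧
        -- the phase states form a group, isomorphic to `G ^ H`; the classical points form a
        -- subgroup, which corresponds to the constant vectors; the extension is trivial
        ∃ (_ : AddCommGroup Z.PhaseState) (Φ : Z.PhaseState ≃+ (H → G))
          (K : AddSubgroup Z.PhaseState),
          (∀ α β : Z.PhaseState, (α + β).state = Z.add α.state β.state) ∧
          (∀ α : Z.PhaseState, Mermin.FRel.toSet α.state = {a | (e a).1 = Φ α (e a).2}) ∧
          (∀ α : Z.PhaseState, α ∈ K ↔ X.IsClassical α.state) ∧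
          (∀ α : Z.PhaseState, α ∈ K ↔ ∃ g : G, ∀ h : H, Φ α h = g) ∧
          Mermin.TrivialAlgebraicExtension K) ∧
    Mermin.MerminLocal Mermin.FRel.{u} := by
  refine ⟨fun A Z X hA h => ?_, Mermin.FRel.merminLocal⟩
  obtain ⟨G, H, _, _, e, hZ, hX⟩ := Mermin.FRel.exists_isSumOfCopies h
  -- For the swapped bijection the component index of `X` is the `G`-coordinate.
  have hcl (j : 𝟙_ Mermin.FRel.{u} ⟶ A) : X.IsClassical j ↔
      ∃ g : G, Mermin.FRel.toSet j = {a | (e a).1 = g} := hX.isClassical_iff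
  let := hZ.phaseGroup
  let K : AddSubgroup Z.PhaseState :=
    (Pi.constAddMonoidHom H G).range.comap hZ.phaseAddEquiv.toAddMonoidHom
  have hK (α : Z.PhaseState) : α ∈ K ↔ ∃ g : G, ∀ h : H, hZ.phaseAddEquiv α h = g :=
    exists_congr fun g => by rw [eq_comm, funext_iff]; rfl
  refine ⟨G, H, _, _, e, hZ, hX, fun j => hZ.isPhaseState_iff, hcl, _, hZ.phaseAddEquiv, K,
    hZ.phaseGroup_add, hZ.toSet_state, fun α => ?_, hK,
    Mermin.trivialAlgebraicExtension_of_constants 0 hZ.phaseAddEquiv K hK⟩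
  rw [hK, hcl]
  refine exists_congr fun g => ?_
  rw [← funext_iff (g := fun _ => g), hZ.toSet_state]
  exact (Mermin.FRel.graph_injective e).eq_iff.symm
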